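/- **Theorem (Static solution for random erasures).** Let $G$ be a finite acyclic ADT network: every supernode $V$ has input ports $I(V)$ and output ports $O(V)$, and each link (edge) runs from an output port to an input port. Let $S$ be a source with processes $X=(X_1,\dots,X_\mu)$ and let $T_1,\dots,T_N$ be distinct destination supernodes, each of which wants all of $X$ (a multicast connection $\mathcal C$). A linear network code over $\mathbb F_q$ is a choice of coefficients $\alpha_{(k,e)},\beta_{(e',e)},\epsilon_{(e',(T_i,k))}\in\mathbb F_q$, where $1\le k\le\mu$, such that the symbols $Y$ at the ports and the outputs $Z(T_i)=(Z(T_i,1),\dots,Z(T_i,\mu))$ satisfy $$Y(e')=\sum_{e:\,(e,e')\text{ is a link}}Y(e)\quad (e'\in I(V)),$$ $$Y(e)=\sum_{e'\in I(V)}\beta_{(e',e)}Y(e')+[V=S]\sum_{k=1}^{\mu}\alpha_{(k,e)}X_k\quad (e\in O(V)),$$ $$Z(T_i,k)=\sum_{e'\in I(T_i)}\epsilon_{(e',(T_i,k))}Y(e').$$ For a set $f$ of links let $G_f$ be $G$ with the links in $f$ deleted. Say that $(G_f,\mathcal C)$ is solvable over $\mathbb F_q$ if some code over $\mathbb F_q$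 gives $Z(T_i)=X$ on $G_f$ for every $i$ and every $X\in\mathbb F_q^\mu$. A code is a *static solution* for a family of failure sets if, for every $f$ in the family, with all its coefficients (which may not depend on $f$) kept fixed, every $T_i$ can recover $X$ linearly from $Z(T_i)$ on $G_f$; that is, the $\mu\times\mu$ system matrix $M_{f,i}$ given by $Z(T_i)=X M_{f,i}$ is invertible for all $i$ and all $f$ in the family. Fix a prime $p$, and let $\mathcal F$ be the set of all sets $f$ of links of $G$ such that $(G_f,\mathcal C)$ is solvable over some finite field of characteristic $p$. Then: 1. There is a static solution for $\mathcal F$ over some finite field of characteristic $p$. 2. Whenever $\mathbb F_q$ has characteristic $p$ and $q>|\mathcal F|\,N$, there is a static solution for $\mathcal F$ over $\mathbb F_q$. 3. The same holds for solvability over the given field alone: if $\mathcal F_q$ is the set of all $f$ such that $(G_f,\mathcal C)$ is solvable over $\mathbb F_q$, and $q>|\mathcal F_q|\,N$, there is a static solution for $\mathcal F_q$ over $\mathbb F_q$. -/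

import Mathlib

/-- An ADT network: a directed graph on supernodes `V`. Every supernode owns input ports (from `I`)
and output ports (from `O`); an edge runs from an output port to an input port. -/
structure ADTNetwork (V I O : Type*) where
  /-- the supernode owning an input port -/
  inNode : I → V
  /-- the supernode owning an output port -/
  outNode : O → V
  /-- the links -/
  edges : Finset (O × I)

/-- There is a link from an output port of `u` to an input port of `v`. -/
def ADTNetwork.Link {V I O : Type*} (G : ADTNetwork V I O) (u v : V) : Prop :=
  ∃ e ∈ G.edges, G.outNode e.1 = u ∧ G.inNode e.2 = v

/-- No directed cycle of supernodes. -/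
def ADTNetwork.Acyclic {V I O : Type*} (G : ADTNetwork V I O) : Prop :=
  ∀ v, ¬ Relation.TransGen G.Link v v

/-- A multicast problem: the source supernode has `rate` source processes, all of which every
destination wants. -/
structure MulticastProblem (V I O : Type*) extends ADTNetwork V I O where
  source : V
  dests : Finset V
  rate : ℕ

/-- A linear network code over `K` for `μ` source processes. The coefficient `ε i k` is the one
used by the supernode owning `i` for its `k`-th decoded process, so it needs no further index.
`β i o` is used only if `i` and `o` belong to the same supernode, and `α k o` only if `o` is
an output port of the source. -/
structure NetworkCode (I O K : Type*) (μ : ℕ) where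
  α : Fin μ → O → K
  β : I → O → K
  ε : I → Fin μ → K

namespace MulticastProblem

variable {V I O : Type*} [DecidableEq V] [Fintype I] [DecidableEq I] [Fintype O] [DecidableEq O]

/-- The same problem after the links in `f` have failed (been deleted). -/
abbrev fail (P : MulticastProblem V I O) (f : Finset (O × I)) : MulticastProblem V I O :=
  { P with edges := P.edges \ f }

/-- `yI`, `yO` are the symbols at the input and output ports when the source symbols are `x` and
the supernodes use the code `c`: symbols superpose at input ports (an output port sends the same
symbol on all its links), and output ports send linear combinations of the symbols at the input
ports of their supernode and, at the source, of the source symbols. -/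
def IsFlow {K : Type*} [Field K] (P : MulticastProblem V I O) (c : NetworkCode I O K P.rate)
    (x : Fin P.rate → K) (yI : I → K) (yO : O → K) : Prop :=
  (∀ i, yI i = ∑ o with (o, i) ∈ P.edges, yO o) ∧
  (∀ o, yO o = (∑ i with P.inNode i = P.outNode o, c.β i o * yI i) +
    (if P.outNode o = P.source then ∑ k, c.α k o * x k else 0))

/-- The processes `Z(T, k)` that supernode `T` forms from the symbols at its input ports. -/
def output {K : Type*} [Field K] (P : MulticastProblem V I O) (c : NetworkCode I O K P.rate)
    (T : V) (yI : I → K) : Fin P.rate → K :=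
  fun k => ∑ i with P.inNode i = T, c.ε i k * yI i

/-- With the code `c`, every destination's output equals the source vector, `Z(T) = X(S)`,
whatever the source vector is. (In an acyclic network the port symbols exist and are unique.) -/
def Establishes {K : Type*} [Field K] (P : MulticastProblem V I O)
    (c : NetworkCode I O K P.rate) : Prop :=
  ∀ x, (∃ yI yO, P.IsFlow c x yI yO) ∧
    ∀ yI yO, P.IsFlow c x yI yO → ∀ T ∈ P.dests, P.output c T yI = x

/-- The multicast problem is solvable over `K`. -/
def Solvable (P : MulticastProblem V I O) (K : Type*) [Field K] : Prop :=
  ∃ c : NetworkCode I O K P.rate, P.Establishes c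

/-- With the code `c`, every destination `T` can linearly decode the source vector from its
output `Z(T)`. As `Z(T) = X(S) M` for a square system matrix `M`, this says that `M` is invertible
for every destination, the decoding matrix `D` being the inverse of `M`. -/
def Decodes {K : Type*} [Field K] (P : MulticastProblem V I O)
    (c : NetworkCode I O K P.rate) : Prop :=
  ∀ T ∈ P.dests, ∃ D : Matrix (Fin P.rate) (Fin P.rate) K,
    ∀ x, (∃ yI yO, P.IsFlow c x yI yO) ∧
      ∀ yI yO, P.IsFlow c x yI yO → Matrix.vecMul (P.output c T yI) D = x

/-- The code `c`, without any change of its coefficients, achieves the multicast rate under every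
failure pattern in `𝓕`. -/
def IsStaticSolution {K : Type*} [Field K] (P : MulticastProblem V I O)
    (𝓕 : Set (Finset (O × I))) (c : NetworkCode I O K P.rate) : Prop :=
  ∀ f ∈ 𝓕, (P.fail f).Decodes c

/-- All link failure patterns under which the problem is solvable over the field `K`. -/
def solvableFailures (P : MulticastProblem V I O) (K : Type*) [Field K] :
    Set (Finset (O × I)) :=
  {f | f ⊆ P.edges ∧ (P.fail f).Solvable K}

/-- All link failure patterns under which the problem is solvable over some finite field of
characteristic `p`, of whatever size (every finite field has a copy in `Type`). -/
def solvableFailuresChar (P : MulticastProblem V I O) (p : ℕ) : Set (Finset (O × I)) :=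
  {f | f ⊆ P.edges ∧ ∃ (L : Type) (_ : Field L) (_ : Finite L) (_ : CharP L p),
    (P.fail f).Solvable L}

end MulticastProblem

/-! The port symbols solve a linear system `F y = S x`, and acyclicity makes `F` invertible, so that
`Z(T) = M x` with `M = C F⁻¹ S`. The matrix `F⁻¹` is not polynomial in the coefficients of the code,
but by the Schur complement the Edmonds matrix `[F, -S; C, 0]` has determinant `det F * det M`.
Each coefficient occurs in a single row of this matrix, so its determinant is a polynomial of degree
at most `1` in every coefficient, and it is defined over the prime field. Solvability of `G_f` makes
this polynomial nonzero for each destination; the product of these polynomials over all `f` and `T`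
has degree at most `|𝓕| N` in each variable and so does not vanish identically on a field with more
than `|𝓕| N` elements. -/

open Finset Matrix

theorem exists_finite_field_charP_lt_card (p : ℕ) [Fact p.Prime] (n : ℕ) :
    ∃ (K : Type) (_ : Field K) (_ : Finite K) (_ : CharP K p), n < Nat.card K := by
  refine ⟨GaloisField p (n + 1), inferInstance, inferInstance, inferInstance, ?_⟩
  rw [GaloisField.card p (n + 1) n.succ_ne_zero]
  exact n.lt_succ_self.trans (Nat.lt_pow_self (Fact.out : p.Prime).one_lt)

theorem exists_finset_lt_card_of_lt_enatCard {α : Type*} {n : ℕ} (h : n < ENat.card α) :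
    ∃ s : Finset α, n < #s := by
  rw [← Set.encard_univ, ← ENat.add_one_le_iff (ENat.natCast_ne_top n)] at h
  obtain ⟨t, -, ht⟩ := Set.exists_subset_encard_eq h
  have ht_finite : t.Finite := Set.finite_of_encard_eq_coe (k := n + 1) ht
  refine ⟨ht_finite.toFinset, ?_⟩
  rw [ht_finite.encard_eq_coe_toFinset_card] at ht
  have : #ht_finite.toFinset = n + 1 := by exact_mod_cast ht
  lia

theorem exists_forall_eval_ne_zero {σ ι R : Type*} [Finite σ] [CommRing R] [IsDomain R]
    {s : Finset ι} {f : ι → MvPolynomial σ R} (hf : ∀ i ∈ s, f i ≠ 0)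
    (hdeg : ∀ v, (∑ i ∈ s, (f i).degreeOf v : ℕ) < ENat.card R) :
    ∃ a : σ → R, ∀ i ∈ s, MvPolynomial.eval a (f i) ≠ 0 := by
  choose S hS using fun v => exists_finset_lt_card_of_lt_enatCard (hdeg v)
  have hprod : ∏ i ∈ s, f i ≠ 0 := Finset.prod_ne_zero_iff.2 hf
  contrapose! hprod
  refine MvPolynomial.eq_zero_of_eval_zero_at_prod_finset _ S
    (fun v => (MvPolynomial.degreeOf_prod_le v s f).trans_lt (hS v)) fun a _ => ?_
  obtain ⟨i, hi, hai⟩ := hprod a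
  rw [map_prod, Finset.prod_eq_zero hi hai]

theorem degreeOf_det_le_sum {σ n R : Type*} [Fintype n] [DecidableEq n] [CommRing R]
    {M : Matrix n n (MvPolynomial σ R)} {v : σ} {d : n → ℕ}
    (h : ∀ i j, (M i j).degreeOf v ≤ d i) : M.det.degreeOf v ≤ ∑ i, d i := by
  rw [← Matrix.det_transpose, Matrix.det_apply]
  refine (MvPolynomial.degreeOf_sum_le v _ _).trans (Finset.sup_le fun s _ => ?_)
  have hprod : (∏ i, Mᵀ (s i) i).degreeOf v ≤ ∑ i, d i :=
    (MvPolynomial.degreeOf_prod_le v _ _).trans (Finset.sum_le_sum fun i _ => h i (s i))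
  rcases Int.units_eq_one_or (Equiv.Perm.sign s) with hs | hs
  · rwa [hs, one_smul]
  · rwa [hs, Units.neg_smul, one_smul, MvPolynomial.degreeOf_neg]

theorem ADTNetwork.Acyclic.wellFounded_link {V I O ι : Type*} {G : ADTNetwork V I O}
    [Finite ι] (hG : G.Acyclic) (node : ι → V) :
    WellFounded (InvImage G.Link node) := by
  let r := InvImage (Relation.TransGen G.Link) node
  have : Std.Irrefl r := ⟨fun a => hG (node a)⟩
  have : IsTrans ι r := ⟨fun _ _ _ => Relation.TransGen.trans⟩
  have hsub : Subrelation (InvImage G.Link node) r := fun {a b} (h : G.Link (node a) (node b)) =>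
    Relation.TransGen.single h
  exact hsub.wf (Finite.wellFounded_of_trans_of_irrefl r)

/-- The variables of the generic network code, one for each coefficient of a code. -/
inductive CodeVar (I O : Type*) (μ : ℕ)
  | α (k : Fin μ) (o : O)
  | β (i : I) (o : O)
  | ε (i : I) (k : Fin μ)

instance CodeVar.instFinite {I O : Type*} [Finite I] [Finite O] {μ : ℕ} :
    Finite (CodeVar I O μ) := by
  let ofSum : (Fin μ × O) ⊕ (I × O) ⊕ (I × Fin μ) → CodeVar I O μ :=
    Sum.elim (fun x => .α x.1 x.2) (Sum.elim (fun x => .β x.1 x.2) fun x => .ε x.1 x.2)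
  refine Finite.of_surjective ofSum ?_
  rintro (⟨k, o⟩ | ⟨i, o⟩ | ⟨i, k⟩)
  exacts [⟨.inl (k, o), rfl⟩, ⟨.inr (.inl (i, o)), rfl⟩, ⟨.inr (.inr (i, k)), rfl⟩]

namespace NetworkCode

variable {I O R : Type*} {μ : ℕ}

/-- The code with a prescribed value for each coefficient, that is, the specialization of the
generic code at `a`. -/
def ofCoeffs (a : CodeVar I O μ → R) : NetworkCode I O R μ where
  α k o := a (.α k o)
  β i o := a (.β i o)
  ε i k := a (.ε i k)

theorem exists_eq_ofCoeffs (c : NetworkCode I O R μ) : ∃ a, c = ofCoeffs a :=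
  ⟨fun | .α k o => c.α k o | .β i o => c.β i o | .ε i k => c.ε i k, rfl⟩

end NetworkCode

namespace MulticastProblem

open NetworkCode

variable {V I O : Type*} [DecidableEq V] [DecidableEq I] [DecidableEq O]

omit [DecidableEq V] in
theorem acyclic_fail {P : MulticastProblem V I O} (hP : P.toADTNetwork.Acyclic)
    (f : Finset (O × I)) : (P.fail f).toADTNetwork.Acyclic := fun v hv =>
  hP v (hv.lift id fun _ _ ⟨e, he, hlink⟩ => ⟨e, (Finset.mem_sdiff.1 he).1, hlink⟩)

section Matrices

variable {R : Type*} [CommRing R] (P : MulticastProblem V I O) (c : NetworkCode I O R P.rate)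

/-- The matrix `F` of the flow equations `F y = S x`, where `y` lists the symbols at the input ports
and then those at the output ports. -/
def flowMatrix : Matrix (I ⊕ O) (I ⊕ O) R :=
  fromBlocks 1 (-of fun i o => if (o, i) ∈ P.edges then 1 else 0)
    (-of fun o i => if P.inNode i = P.outNode o then c.β i o else 0) 1

omit [DecidableEq I] [DecidableEq O] in
/-- The matrix `S` of the flow equations `F y = S x`, by which the source symbols enter the
network. -/
def sourceMatrix : Matrix (I ⊕ O) (Fin P.rate) R :=
  fromRows 0 (of fun o k => if P.outNode o = P.source then c.α k o else 0)

/-- The matrix `C` that maps the port symbols `y` to the output `Z(T)`. -/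
def outputMatrix (T : V) : Matrix (Fin P.rate) (I ⊕ O) R :=
  fromCols (of fun k i => if P.inNode i = T then c.ε i k else 0) 0

/-- The Edmonds matrix of the destination `T`, whose Schur complement is the system matrix. -/
def edmondsMatrix (T : V) : Matrix ((I ⊕ O) ⊕ Fin P.rate) ((I ⊕ O) ⊕ Fin P.rate) R :=
  fromBlocks (P.flowMatrix c) (-P.sourceMatrix c) (P.outputMatrix c T) 0

/-- The system matrix `M` of the destination `T`, acting on column vectors: `Z(T) = M x`. It is the
transpose of the matrix in `Z(T) = X M`. -/
noncomputable def systemMatrix [Fintype I] [Fintype O] (T : V) :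
    Matrix (Fin P.rate) (Fin P.rate) R :=
  P.outputMatrix c T * (P.flowMatrix c)⁻¹ * P.sourceMatrix c

variable {P c}

theorem det_edmondsMatrix [Fintype I] [Fintype O] (hF : IsUnit (P.flowMatrix c)) (T : V) :
    (P.edmondsMatrix c T).det = (P.flowMatrix c).det * (P.systemMatrix c T).det := by
  have := hF.invertible
  rw [edmondsMatrix, det_fromBlocks₁₁, invOf_eq_nonsing_inv, Matrix.mul_neg, sub_neg_eq_add,
    zero_add, systemMatrix]

end Matrices

section Flows

variable [Fintype I] [Fintype O] {K : Type*} [Field K] {P : MulticastProblem V I O}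
  {c : NetworkCode I O K P.rate} {x : Fin P.rate → K} {yI : I → K} {yO : O → K} {T : V}

theorem isFlow_iff_mulVec_eq :
    P.IsFlow c x yI yO ↔ P.flowMatrix c *ᵥ Sum.elim yI yO = P.sourceMatrix c *ᵥ x := by
  have hlinks : ∀ i, ((of fun i o => if (o, i) ∈ P.edges then (1 : K) else 0) *ᵥ yO) i =
      ∑ o with (o, i) ∈ P.edges, yO o := fun i => by
    simp only [mulVec, dotProduct, of_apply, ite_mul, one_mul, zero_mul, Finset.sum_filter]
  have hcoding : ∀ o, ((of fun o i => if P.inNode i = P.outNode o then c.β i o else 0) *ᵥ yI) o =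
      ∑ i with P.inNode i = P.outNode o, c.β i o * yI i := fun o => by
    simp only [mulVec, dotProduct, of_apply, ite_mul, zero_mul, Finset.sum_filter]
  have hsource : ∀ o, ((of fun o k => if P.outNode o = P.source then c.α k o else 0) *ᵥ x) o =
      if P.outNode o = P.source then ∑ k, c.α k o * x k else 0 := fun o => by
    simp only [mulVec, dotProduct, of_apply, ite_mul, zero_mul]
    split_ifs <;> simp
  simp only [IsFlow, flowMatrix, sourceMatrix, fromBlocks_mulVec, fromRows_mulVec,
    Sum.elim_comp_inl, Sum.elim_comp_inr, neg_mulVec, one_mulVec, zero_mulVec, funext_iff,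
    Sum.forall, Sum.elim_inl, Sum.elim_inr, Pi.add_apply, Pi.neg_apply, Pi.zero_apply, hlinks,
    hcoding, hsource, add_neg_eq_zero, neg_add_eq_iff_eq_add]

omit [DecidableEq I] [DecidableEq O] in
theorem output_eq_mulVec : P.output c T yI = P.outputMatrix c T *ᵥ Sum.elim yI yO := by
  ext k
  simp [output, outputMatrix, mulVec, dotProduct, Finset.sum_filter, ite_mul]

theorem IsFlow.eq_zero (hP : P.toADTNetwork.Acyclic) (h : P.IsFlow c 0 yI yO) :
    yI = 0 ∧ yO = 0 := by
  have hO : ∀ o, yO o = 0 := fun o => by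
    induction o using (hP.wellFounded_link P.outNode).induction with
    | _ o ih =>
      have hI : ∀ i, P.inNode i = P.outNode o → yI i = 0 := fun i hi =>
        (h.1 i).trans <| Finset.sum_eq_zero fun o' ho' =>
          ih o' ⟨(o', i), (Finset.mem_filter.1 ho').2, rfl, hi⟩
      rw [h.2 o, Finset.sum_eq_zero fun i hi => by rw [hI i (Finset.mem_filter.1 hi).2, mul_zero]]
      simp
  exact ⟨funext fun i => (h.1 i).trans (Finset.sum_eq_zero fun o _ => hO o), funext hO⟩

theorem isUnit_flowMatrix (hP : P.toADTNetwork.Acyclic) : IsUnit (P.flowMatrix c) := by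
  rw [isUnit_iff_isUnit_det, isUnit_iff_ne_zero, Ne, ← exists_mulVec_eq_zero_iff]
  rintro ⟨y, hy, hy0⟩
  have hflow : P.IsFlow c 0 (y ∘ Sum.inl) (y ∘ Sum.inr) := by
    rw [isFlow_iff_mulVec_eq, Sum.elim_comp_inl_inr, hy0, mulVec_zero]
  obtain ⟨hI, hO⟩ := hflow.eq_zero hP
  exact hy (by rw [← Sum.elim_comp_inl_inr y, hI, hO, Sum.elim_zero_zero])

theorem isFlow_iff_eq_mulVec (hP : P.toADTNetwork.Acyclic) :
    P.IsFlow c x yI yO ↔ Sum.elim yI yO = (P.flowMatrix c)⁻¹ *ᵥ P.sourceMatrix c *ᵥ x := by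
  have hF := (isUnit_iff_isUnit_det _).1 (isUnit_flowMatrix (c := c) hP)
  rw [isFlow_iff_mulVec_eq]
  refine ⟨fun h => ?_, fun h => ?_⟩
  · rw [← h, mulVec_mulVec, nonsing_inv_mul _ hF, one_mulVec]
  · rw [h, mulVec_mulVec, mul_nonsing_inv _ hF, one_mulVec]

theorem exists_isFlow (hP : P.toADTNetwork.Acyclic) (c : NetworkCode I O K P.rate)
    (x : Fin P.rate → K) : ∃ yI yO, P.IsFlow c x yI yO := by
  let y := (P.flowMatrix c)⁻¹ *ᵥ P.sourceMatrix c *ᵥ x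
  exact ⟨y ∘ Sum.inl, y ∘ Sum.inr, (isFlow_iff_eq_mulVec hP).2 (Sum.elim_comp_inl_inr y)⟩

theorem IsFlow.output_eq (hP : P.toADTNetwork.Acyclic) (h : P.IsFlow c x yI yO) (T : V) :
    P.output c T yI = P.systemMatrix c T *ᵥ x := by
  rw [output_eq_mulVec (yO := yO), (isFlow_iff_eq_mulVec hP).1 h, systemMatrix, mulVec_mulVec,
    mulVec_mulVec, Matrix.mul_assoc]

theorem Establishes.systemMatrix_eq_one (hP : P.toADTNetwork.Acyclic) (hc : P.Establishes c)
    (hT : T ∈ P.dests) : P.systemMatrix c T = 1 := by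
  refine mulVec_injective (funext fun x => ?_)
  obtain ⟨yI, yO, h⟩ := exists_isFlow hP c x
  rw [← h.output_eq hP, (hc x).2 yI yO h T hT, one_mulVec]

theorem Establishes.det_edmondsMatrix_ne_zero (hP : P.toADTNetwork.Acyclic)
    (hc : P.Establishes c) (hT : T ∈ P.dests) : (P.edmondsMatrix c T).det ≠ 0 := by
  have hF := isUnit_flowMatrix (c := c) hP
  rw [det_edmondsMatrix hF, hc.systemMatrix_eq_one hP hT, det_one, mul_one]
  exact ((isUnit_iff_isUnit_det _).1 hF).ne_zero

theorem decodes_of_det_systemMatrix_ne_zero (hP : P.toADTNetwork.Acyclic)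
    (h : ∀ T ∈ P.dests, (P.systemMatrix c T).det ≠ 0) : P.Decodes c := by
  refine fun T hT => ⟨(P.systemMatrix c T)⁻¹ᵀ, fun x =>
    ⟨exists_isFlow hP c x, fun yI yO hflow => ?_⟩⟩
  rw [hflow.output_eq hP, vecMul_transpose, mulVec_mulVec,
    nonsing_inv_mul _ (h T hT).isUnit, one_mulVec]

theorem decodes_of_det_edmondsMatrix_ne_zero (hP : P.toADTNetwork.Acyclic)
    (h : ∀ T ∈ P.dests, (P.edmondsMatrix c T).det ≠ 0) : P.Decodes c :=
  decodes_of_det_systemMatrix_ne_zero hP fun T hT =>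
    right_ne_zero_of_mul ((det_edmondsMatrix (isUnit_flowMatrix hP) T).symm.trans_ne (h T hT))

end Flows

section EdmondsPolynomial

variable {R S : Type*} [CommRing R] [CommRing S]

theorem map_edmondsMatrix_ofCoeffs (φ : R →+* S) (P : MulticastProblem V I O)
    (a : CodeVar I O P.rate → R) (T : V) :
    (P.edmondsMatrix (ofCoeffs a) T).map φ = P.edmondsMatrix (ofCoeffs (φ ∘ a)) T := by
  ext ((_ | _) | _) ((_ | _) | _) <;>
    simp [edmondsMatrix, flowMatrix, sourceMatrix, outputMatrix, ofCoeffs, one_apply, apply_ite φ]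

/-- The row of the Edmonds matrix that contains a given coefficient of the code. -/
def edmondsRow {μ : ℕ} : CodeVar I O μ → (I ⊕ O) ⊕ Fin μ
  | .α _ o => .inl (.inr o)
  | .β _ o => .inl (.inr o)
  | .ε _ k => .inr k

theorem degreeOf_edmondsMatrix_ofCoeffs_X_le [Nontrivial R] (P : MulticastProblem V I O) (T : V)
    (v : CodeVar I O P.rate) (a b : (I ⊕ O) ⊕ Fin P.rate) :
    (P.edmondsMatrix (ofCoeffs (MvPolynomial.X (R := R))) T a b).degreeOf v ≤
      if a = edmondsRow v then 1 else 0 := by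
  classical
  rcases v with ⟨k, o⟩ | ⟨i, o⟩ | ⟨i, k⟩ <;>
    rcases a with (_ | _) | _ <;> rcases b with (_ | _) | _ <;>
    simp [edmondsMatrix, flowMatrix, sourceMatrix, outputMatrix, ofCoeffs, edmondsRow, one_apply,
      apply_ite (MvPolynomial.degreeOf _), MvPolynomial.degreeOf_X, MvPolynomial.degreeOf_neg] <;>
    grind

variable [Fintype I] [Fintype O]

/-- The determinant of the Edmonds matrix of the generic code, as a polynomial in the coefficients
of the code. -/
noncomputable def edmondsPoly (R : Type*) [CommRing R] (P : MulticastProblem V I O) (T : V) :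
    MvPolynomial (CodeVar I O P.rate) R :=
  (P.edmondsMatrix (ofCoeffs MvPolynomial.X) T).det

theorem map_edmondsPoly (φ : R →+* S) (P : MulticastProblem V I O) (T : V) :
    MvPolynomial.map φ (P.edmondsPoly R T) = P.edmondsPoly S T := by
  rw [edmondsPoly, RingHom.map_det, RingHom.mapMatrix_apply, map_edmondsMatrix_ofCoeffs,
    edmondsPoly]
  congr
  ext1 v
  simp

theorem eval_edmondsPoly (P : MulticastProblem V I O) (a : CodeVar I O P.rate → R) (T : V) :
    MvPolynomial.eval a (P.edmondsPoly R T) = (P.edmondsMatrix (ofCoeffs a) T).det := by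
  rw [edmondsPoly, RingHom.map_det, RingHom.mapMatrix_apply, map_edmondsMatrix_ofCoeffs]
  congr
  ext v
  simp

theorem degreeOf_edmondsPoly_le_one [Nontrivial R] (P : MulticastProblem V I O) (T : V)
    (v : CodeVar I O P.rate) : (P.edmondsPoly R T).degreeOf v ≤ 1 := by
  simpa [edmondsPoly] using degreeOf_det_le_sum (P.degreeOf_edmondsMatrix_ofCoeffs_X_le T v)

theorem edmondsPoly_ne_zero_of_charP {K L : Type*} [Field K] [Field L] (p : ℕ) [CharP K p]
    [CharP L p] {P : MulticastProblem V I O} {T : V} (h : P.edmondsPoly L T ≠ 0) :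
    P.edmondsPoly K T ≠ 0 := by
  have hzmod : P.edmondsPoly (ZMod p) T ≠ 0 := fun h0 => h <| by
    rw [← map_edmondsPoly (ZMod.castHom dvd_rfl L), h0, map_zero]
  rw [← map_edmondsPoly (ZMod.castHom dvd_rfl K)]
  exact (map_ne_zero_iff _ (MvPolynomial.map_injective _ (ZMod.castHom_injective K))).2 hzmod

theorem Solvable.edmondsPoly_ne_zero {K : Type*} [Field K] {P : MulticastProblem V I O}
    (hP : P.toADTNetwork.Acyclic) (h : P.Solvable K) {T : V} (hT : T ∈ P.dests) :
    P.edmondsPoly K T ≠ 0 := by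
  obtain ⟨c, hc⟩ := h
  obtain ⟨a, rfl⟩ := c.exists_eq_ofCoeffs
  intro h0
  refine hc.det_edmondsMatrix_ne_zero hP hT ?_
  rw [← eval_edmondsPoly, h0, map_zero]

theorem exists_isStaticSolution_of_edmondsPoly_ne_zero {K : Type*} [Field K]
    {P : MulticastProblem V I O} (hP : P.toADTNetwork.Acyclic) {𝓕 : Set (Finset (O × I))}
    (h𝓕 : ∀ f ∈ 𝓕, ∀ T ∈ P.dests, (P.fail f).edmondsPoly K T ≠ 0)
    (hK : (𝓕.ncard * #P.dests : ℕ) < ENat.card K) :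
    ∃ c : NetworkCode I O K P.rate, P.IsStaticSolution 𝓕 c := by
  have hfin : 𝓕.Finite := 𝓕.toFinite
  obtain ⟨a, ha⟩ : ∃ a : CodeVar I O P.rate → K, ∀ e ∈ hfin.toFinset ×ˢ P.dests,
      MvPolynomial.eval a ((P.fail e.1).edmondsPoly K e.2) ≠ 0 := by
    refine exists_forall_eval_ne_zero (fun e he => ?_) fun v => lt_of_le_of_lt ?_ hK
    · obtain ⟨hf, hT⟩ := Finset.mem_product.1 he
      exact h𝓕 e.1 (hfin.mem_toFinset.1 hf) e.2 hT
    · rw [Set.ncard_eq_toFinset_card 𝓕 hfin, ← Finset.card_product, Nat.cast_le]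
      simpa only [smul_eq_mul, mul_one] using
        Finset.sum_le_card_nsmul (hfin.toFinset ×ˢ P.dests) _ 1 fun e _ =>
          degreeOf_edmondsPoly_le_one (R := K) (P.fail e.1) e.2 v
  refine ⟨ofCoeffs a, fun f hf =>
    decodes_of_det_edmondsMatrix_ne_zero (acyclic_fail hP f) fun T hT => ?_⟩
  rw [← eval_edmondsPoly]
  exact ha (f, T) (Finset.mem_product.2 ⟨hfin.mem_toFinset.2 hf, hT⟩)

theorem exists_isStaticSolution_of_solvable {K : Type*} [Field K] (p : ℕ) [CharP K p]
    {P : MulticastProblem V I O} (hP : P.toADTNetwork.Acyclic) {𝓕 : Set (Finset (O × I))}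
    (h𝓕 : ∀ f ∈ 𝓕, ∃ (L : Type*) (_ : Field L) (_ : CharP L p), (P.fail f).Solvable L)
    (hK : (𝓕.ncard * #P.dests : ℕ) < ENat.card K) :
    ∃ c : NetworkCode I O K P.rate, P.IsStaticSolution 𝓕 c := by
  refine exists_isStaticSolution_of_edmondsPoly_ne_zero hP (fun f hf T hT => ?_) hK
  obtain ⟨L, _, _, hL⟩ := h𝓕 f hf
  exact edmondsPoly_ne_zero_of_charP p (hL.edmondsPoly_ne_zero (acyclic_fail hP f) hT)

end EdmondsPolynomial

end MulticastProblem

theorem mainTheorem9_general {V I O : Type*} [DecidableEq V]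
    [Fintype I] [DecidableEq I] [Fintype O] [DecidableEq O]
    {P : MulticastProblem V I O} (hP : P.toADTNetwork.Acyclic) {p : ℕ} (hp : p.Prime)
    {𝓕 : Set (Finset (O × I))}
    (h𝓕 : ∀ f ∈ 𝓕, ∃ (L : Type*) (_ : Field L) (_ : CharP L p), (P.fail f).Solvable L) :
    (∃ (K : Type) (_ : Field K) (_ : Finite K) (_ : CharP K p)
      (c : NetworkCode I O K P.rate), P.IsStaticSolution 𝓕 c) ∧
    (∀ (K : Type*) [Field K] [CharP K p], (𝓕.ncard * #P.dests : ℕ) < ENat.card K →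
      ∃ c : NetworkCode I O K P.rate, P.IsStaticSolution 𝓕 c) := by
  have : Fact p.Prime := ⟨hp⟩
  refine ⟨?_, fun K _ _ hK => MulticastProblem.exists_isStaticSolution_of_solvable p hP h𝓕 hK⟩
  obtain ⟨K, _, _, _, hK⟩ := exists_finite_field_charP_lt_card p (𝓕.ncard * #P.dests)
  exact ⟨K, ‹_›, ‹_›, ‹_›, MulticastProblem.exists_isStaticSolution_of_solvable p hP h𝓕
    (by rwa [ENat.card_eq_coe_natCard, Nat.cast_lt])⟩

theorem mainTheorem9 {V I O : Type*} [DecidableEq V]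
    [Fintype I] [DecidableEq I] [Fintype O] [DecidableEq O]
    (P : MulticastProblem V I O) (hP : P.toADTNetwork.Acyclic) (p : ℕ) (hp : p.Prime) :
    (∃ (K : Type) (_ : Field K) (_ : Finite K) (_ : CharP K p)
      (c : NetworkCode I O K P.rate), P.IsStaticSolution (P.solvableFailuresChar p) c) ∧
    (∀ (K : Type*) [Field K] [Finite K] [CharP K p],
      (P.solvableFailuresChar p).ncard * P.dests.card < Nat.card K →
        ∃ c : NetworkCode I O K P.rate, P.IsStaticSolution (P.solvableFailuresChar p) c) ∧
    (∀ (K : Type*) [Field K] [Finite K] [CharP K p],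
      (P.solvableFailures K).ncard * P.dests.card < Nat.card K →
        ∃ c : NetworkCode I O K P.rate, P.IsStaticSolution (P.solvableFailures K) c) := by
  have h := mainTheorem9_general hP hp (𝓕 := P.solvableFailuresChar p)
    fun f ⟨_, L, _, _, _, hL⟩ => ⟨L, _, ‹_›, hL⟩
  refine ⟨h.1, fun K _ _ _ hK => h.2 K ?_, fun K _ _ _ hK => (mainTheorem9_general hP hp
    fun f hf => ⟨K, _, ‹_›, hf.2⟩).2 K ?_⟩
  all_goals rwa [ENat.card_eq_coe_natCard, Nat.cast_lt]
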